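/- Let $J\ge 1$ and let $\mathcal Z=\mathcal Z_1\times\cdots\times\mathcal Z_J$ be a product of Euclidean (finite-dimensional real inner product) spaces, with the inner product $\langle x,y\rangle=\sum_{j=1}^J\langle x_j,y_j\rangle_{\mathcal Z_j}$. Let $T:\mathcal Z\to\mathcal Z$, $Tx=(T_1x,\dots,T_Jx)$, be nonexpansive, i.e. $\|Tx-Ty\|\le\|x-y\|$ for all $x,y\in\mathcal Z$, and suppose that $\mathrm{Fix}(T)=\{x\in\mathcal Z: Tx=x\}$ is nonempty. For $\vartheta\subseteq\mathcal J=\{1,\dots,J\}$ let $\hat T^{(\vartheta)}:\mathcal Z\to\mathcal Z$ be given by $\hat T^{(\vartheta)}_jx=T_jx$ if $j\in\vartheta$ and $\hat T^{(\vartheta)}_jx=x_j$ otherwise. Let $(\zeta^k)_{k\ge1}$ be an i.i.d. sequence of random subsets of $\mathcal J$ on a probability space $(\Omega,\mathcal F,\mathbb P)$ such that $$\forall j\in\mathcal J\ \ \exists\,\vartheta\subseteq\mathcal J:\quad j\in\vartheta\ \text{ and }\ \mathbb P(\zeta^1=\vartheta)>0 .$$ Let $(\alpha_k)_{k\ge1}$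 be a nondecreasing real sequence with $\alpha_1=0$ and $0\le\alpha_k\le\alpha<1$ for all $k\ge1$, let $(\rho_k)_{k\ge 1}$ be a real sequence, and let $\rho,\theta,\hat\delta>0$ be such that (i) $\hat\delta>\dfrac{\alpha^2(1+\alpha)+\alpha\theta}{1-\alpha^2}$; (ii) $0<\rho\le\rho_k<\dfrac{\hat\delta-\alpha[\alpha(1+\alpha)+\alpha\hat\delta+\theta]}{\hat\delta[1+\alpha(1+\alpha)+\alpha\hat\delta+\theta]}$ for all $k\ge1$. Let $x^0,x^1\in\mathcal Z$ be arbitrary (deterministic) points and define, for $k\ge1$, $$x^{k+1}=x^k+\alpha_k(x^k-x^{k-1})+\rho_k\bigl[\hat T^{(\zeta^{k+1})}\bigl(x^k+\alpha_k(x^k-x^{k-1})\bigr)-x^k-\alpha_k(x^k-x^{k-1})\bigr].$$ Then, almost surely, the sequence $(x^k)$ converges to some (possibly random) point of $\mathrm{Fix}(T)$. -/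

import Mathlib

noncomputable section

open Classical in
/-- The block operator of `T` for the set of blocks `ϑ`: its `j`-th component at `x` is the `j`-th
component of `T x` if `j ∈ ϑ`, and `x j` otherwise. The space `PiLp 2 Z` is the product of the
spaces `Z j` with the inner product `⟪x, y⟫ = ∑ j, ⟪x j, y j⟫`. -/
def blockOperator {J : ℕ} {Z : Fin J → Type*} (T : PiLp 2 Z → PiLp 2 Z) (ϑ : Set (Fin J))
    (x : PiLp 2 Z) : PiLp 2 Z :=
  WithLp.toLp 2 (fun j => if j ∈ ϑ then T x j else x j)

end

/-!
Give the block `j` the weight `1 / q j`, where `q j` is the probability that it is selected. Then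
the weighted sum over the randomly selected blocks has the unweighted sum over all blocks as its
conditional mean, so nonexpansiveness of `T`, which holds only for all blocks together, controls
the expected decrease of the weighted squared distance `φ n` from `x n` to a fixed point. With
`d n` the weighted squared increment, the bound on the relaxation parameters makes
`φ (n + 1) - a n * φ n + c n * d n` a supermartingale that loses at least `θ * d (n + 1)` in mean.
Hence the mean squared increments are summable, the residuals `T (x n) - x n` tend to `0`, and
`φ n` converges almost surely because the inertial parameters `a n` stay away from `1`. Opial's
argument concludes, with a countable dense set of fixed points to choose one exceptional null set.
-/

open MeasureTheory ProbabilityTheory Filter Topology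

/-! ### Real sequences -/

theorem sub_le_pow_mul_sub {p : ℕ → ℝ} {α κ : ℝ} (hα : 0 ≤ α)
    (h : ∀ n, p (n + 1) ≤ α * p n + (1 - α) * κ) (n : ℕ) :
    p n - κ ≤ α ^ n * (p 0 - κ) :=
  le_geom (u := fun n => p n - κ) hα n fun k _ => by linarith [h k]

theorem exists_forall_le_of_le_mul_add {p : ℕ → ℝ} {α c : ℝ} (hα0 : 0 ≤ α) (hα1 : α < 1)
    (h : ∀ n, p (n + 1) ≤ α * p n + c) : ∃ C, ∀ n, p n ≤ C := by
  refine ⟨c / (1 - α) + |p 0 - c / (1 - α)|, fun n => ?_⟩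
  have hgeom : p n - c / (1 - α) ≤ α ^ n * (p 0 - c / (1 - α)) :=
    sub_le_pow_mul_sub hα0 (fun n => by rw [mul_div_cancel₀ c (sub_pos.2 hα1).ne']; exact h n) n
  have hle : α ^ n * (p 0 - c / (1 - α)) ≤ |p 0 - c / (1 - α)| :=
    (mul_le_mul_of_nonneg_left (le_abs_self _) (pow_nonneg hα0 n)).trans
      (mul_le_of_le_one_left (abs_nonneg _) (pow_le_one₀ hα0 hα1.le))
  linarith

theorem tendsto_zero_of_le_mul_add {e ε : ℕ → ℝ} {α : ℝ} (hα0 : 0 ≤ α) (hα1 : α < 1)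
    (he : ∀ n, 0 ≤ e n) (hε : Tendsto ε atTop (𝓝 0)) (h : ∀ n, e (n + 1) ≤ α * e n + ε n) :
    Tendsto e atTop (𝓝 0) := by
  refine tendsto_order.2 ⟨fun b hb => .of_forall fun n => hb.trans_le (he n), fun b hb => ?_⟩
  obtain ⟨N, hN⟩ := eventually_atTop.1
    (hε.eventually_le_const (mul_pos (sub_pos.2 hα1) (half_pos hb)))
  have hgeom (m : ℕ) : e (m + N) ≤ b / 2 + α ^ m * (e (0 + N) - b / 2) :=
    sub_le_iff_le_add'.1 <| sub_le_pow_mul_sub (p := fun m => e (m + N)) hα0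
      (fun m => by linarith [Nat.add_right_comm m 1 N ▸ h (m + N), hN (m + N) (by omega)]) m
  have hlim : Tendsto (fun m => b / 2 + α ^ m * (e (0 + N) - b / 2)) atTop (𝓝 (b / 2)) := by
    simpa using ((tendsto_pow_atTop_nhds_zero_of_lt_one hα0 hα1).mul_const _).const_add (b / 2)
  rw [← map_add_atTop_eq_nat N, eventually_map]
  filter_upwards [hlim.eventually_lt_const (half_lt_self hb)] with m hm
  exact (hgeom m).trans_lt hm

theorem exists_tendsto_of_tendsto_sub_mul {φ a : ℕ → ℝ} {α aLim u : ℝ}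
    (ha0 : ∀ n, 0 ≤ a n) (haα : ∀ n, a n ≤ α) (hα1 : α < 1) (ha_lim : Tendsto a atTop (𝓝 aLim))
    (hu : Tendsto (fun n => φ (n + 1) - a n * φ n) atTop (𝓝 u)) :
    ∃ l, Tendsto φ atTop (𝓝 l) := by
  have haLim : aLim ≤ α := le_of_tendsto' ha_lim haα
  obtain ⟨l, rfl⟩ : ∃ l, u = (1 - aLim) * l :=
    ⟨u / (1 - aLim), (mul_div_cancel₀ u (by linarith)).symm⟩
  have herr : Tendsto (fun n => |φ (n + 1) - a n * φ n - (1 - a n) * l|) atTop (𝓝 0) := by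
    simpa using (hu.sub ((ha_lim.const_sub 1).mul_const l)).abs
  have hdist : Tendsto (fun n => |φ n - l|) atTop (𝓝 0) :=
    tendsto_zero_of_le_mul_add ((ha0 0).trans (haα 0)) hα1 (fun n => abs_nonneg _) herr fun n =>
      calc |φ (n + 1) - l|
          = |a n * (φ n - l) + (φ (n + 1) - a n * φ n - (1 - a n) * l)| := by ring_nf
        _ ≤ a n * |φ n - l| + |φ (n + 1) - a n * φ n - (1 - a n) * l| :=
            (abs_add_le _ _).trans_eq (by rw [abs_mul, abs_of_nonneg (ha0 n)])
        _ ≤ α * |φ n - l| + |φ (n + 1) - a n * φ n - (1 - a n) * l| := by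
            gcongr
            exact haα n
  exact ⟨l, tendsto_sub_nhds_zero_iff.1 ((tendsto_zero_iff_abs_tendsto_zero _).2 hdist)⟩

/-! ### Weighted squared norms on a product -/

section InnerProduct

variable {E : Type*} [NormedAddCommGroup E] [InnerProductSpace ℝ E]

theorem norm_smul_sq (c : ℝ) (v : E) : ‖c • v‖ ^ 2 = c ^ 2 * ‖v‖ ^ 2 := by
  rw [norm_smul, mul_pow, Real.norm_eq_abs, sq_abs]

theorem norm_add_smul_sub_sub_sq (u v z : E) (a : ℝ) :
    ‖v + a • (v - u) - z‖ ^ 2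
      = (1 + a) * ‖v - z‖ ^ 2 - a * ‖u - z‖ ^ 2 + a * (1 + a) * ‖v - u‖ ^ 2 := by
  have hcomb : v + a • (v - u) - z = (1 + a) • (v - z) - a • (u - z) := by module
  rw [hcomb, ← sub_sub_sub_cancel_right v u z, norm_sub_sq_real (_ • _), norm_sub_sq_real (v - z),
    norm_smul_sq, norm_smul_sq, real_inner_smul_left, real_inner_smul_right]
  ring

theorem norm_add_smul_sq_eq (u v : E) (r : ℝ) :
    ‖u + r • v‖ ^ 2 = ‖u‖ ^ 2 + r * (‖u + v‖ ^ 2 - ‖u‖ ^ 2) - r * (1 - r) * ‖v‖ ^ 2 := by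
  rw [norm_add_sq_real, norm_add_sq_real, norm_smul_sq, real_inner_smul_right]
  ring

theorem le_norm_sub_smul_sq (u v : E) {a b : ℝ} (ha : 0 ≤ a) (hb : 0 < b) :
    b / (a + b) * ‖u‖ ^ 2 - a * b * ‖v‖ ^ 2 ≤ ‖u - a • v‖ ^ 2 := by
  have hsq : ‖u - a • v‖ ^ 2 - (b / (a + b) * ‖u‖ ^ 2 - a * b * ‖v‖ ^ 2)
      = a / (a + b) * ‖u - (a + b) • v‖ ^ 2 := by
    rw [norm_sub_sq_real, norm_sub_sq_real, norm_smul_sq, norm_smul_sq, real_inner_smul_right,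
      real_inner_smul_right]
    field_simp
    ring
  exact sub_nonneg.1 (hsq ▸ by positivity)

end InnerProduct

section WeightedNormSq

variable {ι : Type*} [Fintype ι] {E : ι → Type*} [∀ j, NormedAddCommGroup (E j)]

/-- The squared norm `∑ j, w j * ‖v j‖ ^ 2` on a product space, with weights `w` on the factors.
It is kept as a plain function, since the weights vary while the topology is that of `PiLp 2`. -/
def weightedNormSq (w : ι → ℝ) (v : PiLp 2 E) : ℝ := ∑ j, w j * ‖v j‖ ^ 2

variable {w : ι → ℝ}

theorem weightedNormSq_nonneg (hw : ∀ j, 0 ≤ w j) (v : PiLp 2 E) : 0 ≤ weightedNormSq w v :=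
  Finset.sum_nonneg fun j _ => mul_nonneg (hw j) (sq_nonneg _)

theorem continuous_weightedNormSq (w : ι → ℝ) :
    Continuous (weightedNormSq w : PiLp 2 E → ℝ) := by
  unfold weightedNormSq
  fun_prop

theorem norm_sq_le_weightedNormSq (hw : ∀ j, 1 ≤ w j) (v : PiLp 2 E) :
    ‖v‖ ^ 2 ≤ weightedNormSq w v := by
  rw [PiLp.norm_sq_eq_of_L2]
  exact Finset.sum_le_sum fun j _ => le_mul_of_one_le_left (sq_nonneg _) (hw j)

theorem eq_of_weightedNormSq_sub_eq_zero (hw : ∀ j, 1 ≤ w j) {u v : PiLp 2 E}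
    (h : weightedNormSq w (u - v) = 0) : u = v := by
  have hsq : ‖u - v‖ ^ 2 ≤ 0 := h ▸ norm_sq_le_weightedNormSq hw (u - v)
  exact sub_eq_zero.1 (norm_eq_zero.1 (pow_eq_zero_iff two_ne_zero |>.1
    (hsq.antisymm (sq_nonneg _))))

theorem integrable_weightedNormSq {Ω : Type*} [MeasurableSpace Ω] {P : Measure Ω}
    (w : ι → ℝ) {u : Ω → PiLp 2 E} (hu : MemLp u 2 P) :
    Integrable (fun ω => weightedNormSq w (u ω)) P :=
  integrable_finsetSum _ fun j _ =>
    ((hu.eval_piLp j).integrable_norm_pow two_ne_zero).const_mul (w j)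

theorem weightedNormSq_sub_le (hw : ∀ j, 0 ≤ w j) (u v : PiLp 2 E) :
    weightedNormSq w (u - v) ≤ 2 * weightedNormSq w u + 2 * weightedNormSq w v := by
  simp only [weightedNormSq, Finset.mul_sum, ← Finset.sum_add_distrib]
  refine Finset.sum_le_sum fun j _ => ?_
  calc w j * ‖u j - v j‖ ^ 2
      ≤ w j * (2 * (‖u j‖ ^ 2 + ‖v j‖ ^ 2)) := by
        gcongr
        · exact hw j
        · exact (pow_le_pow_left₀ (norm_nonneg _) (norm_sub_le _ _) 2).trans add_sq_le
    _ = 2 * (w j * ‖u j‖ ^ 2) + 2 * (w j * ‖v j‖ ^ 2) := by ring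

variable [∀ j, InnerProductSpace ℝ (E j)]

theorem weightedNormSq_smul (w : ι → ℝ) (c : ℝ) (v : PiLp 2 E) :
    weightedNormSq w (c • v) = c ^ 2 * weightedNormSq w v := by
  simp only [weightedNormSq, Finset.mul_sum, PiLp.smul_apply, norm_smul_sq, mul_left_comm]

theorem weightedNormSq_add_smul_sub_sub (w : ι → ℝ) (u v z : PiLp 2 E) (a : ℝ) :
    weightedNormSq w (v + a • (v - u) - z)
      = (1 + a) * weightedNormSq w (v - z) - a * weightedNormSq w (u - z)
        + a * (1 + a) * weightedNormSq w (v - u) := by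
  simp only [weightedNormSq, Finset.mul_sum, ← Finset.sum_sub_distrib, ← Finset.sum_add_distrib,
    PiLp.add_apply, PiLp.sub_apply, PiLp.smul_apply, norm_add_smul_sub_sub_sq]
  exact Finset.sum_congr rfl fun j _ => by ring

theorem le_weightedNormSq_sub_smul (hw : ∀ j, 0 ≤ w j) (u v : PiLp 2 E) {a b : ℝ} (ha : 0 ≤ a)
    (hb : 0 < b) :
    b / (a + b) * weightedNormSq w u - a * b * weightedNormSq w v
      ≤ weightedNormSq w (u - a • v) := by
  simp only [weightedNormSq, Finset.mul_sum, ← Finset.sum_sub_distrib]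
  refine Finset.sum_le_sum fun j _ => ?_
  calc b / (a + b) * (w j * ‖u j‖ ^ 2) - a * b * (w j * ‖v j‖ ^ 2)
      = w j * (b / (a + b) * ‖u j‖ ^ 2 - a * b * ‖v j‖ ^ 2) := by ring
    _ ≤ w j * ‖u j - a • v j‖ ^ 2 :=
        mul_le_mul_of_nonneg_left (le_norm_sub_smul_sq _ _ ha hb) (hw j)

end WeightedNormSq

/-! ### Relaxed block steps -/

section BlockStep

variable {J : ℕ} {Z : Fin J → Type*}

theorem blockOperator_apply_of_mem (T : PiLp 2 Z → PiLp 2 Z) {ϑ : Set (Fin J)} {j : Fin J}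
    (hj : j ∈ ϑ) (y : PiLp 2 Z) : blockOperator T ϑ y j = T y j :=
  if_pos hj

theorem blockOperator_apply_of_notMem (T : PiLp 2 Z → PiLp 2 Z) {ϑ : Set (Fin J)} {j : Fin J}
    (hj : j ∉ ϑ) (y : PiLp 2 Z) : blockOperator T ϑ y j = y j :=
  if_neg hj

variable [∀ j, NormedAddCommGroup (Z j)]

theorem continuous_blockOperator {T : PiLp 2 Z → PiLp 2 Z} (hT : Continuous T)
    (ϑ : Set (Fin J)) : Continuous (blockOperator T ϑ) := by
  refine (PiLp.continuous_toLp 2 _).comp (continuous_pi fun j => ?_)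
  split_ifs <;> fun_prop

theorem norm_blockOperator_sub_le (T : PiLp 2 Z → PiLp 2 Z) (ϑ : Set (Fin J)) (y : PiLp 2 Z) :
    ‖blockOperator T ϑ y - y‖ ≤ ‖T y - y‖ := by
  refine le_of_sq_le_sq ?_ (norm_nonneg _)
  rw [PiLp.norm_sq_eq_of_L2, PiLp.norm_sq_eq_of_L2]
  refine Finset.sum_le_sum fun j _ => ?_
  rw [PiLp.sub_apply, PiLp.sub_apply]
  by_cases hj : j ∈ ϑ
  · rw [blockOperator_apply_of_mem T hj]
  · rw [blockOperator_apply_of_notMem T hj, sub_self, norm_zero]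
    gcongr
    exact norm_nonneg _

variable [∀ j, InnerProductSpace ℝ (Z j)]

/-- The relaxed block step: the blocks in `ϑ` move from `y` towards `T y` by the fraction `r`, the
other blocks stay put. -/
noncomputable def relaxedBlockStep (T : PiLp 2 Z → PiLp 2 Z) (ϑ : Set (Fin J)) (r : ℝ)
    (y : PiLp 2 Z) : PiLp 2 Z :=
  y + r • (blockOperator T ϑ y - y)

variable (w : Fin J → ℝ) (T : PiLp 2 Z → PiLp 2 Z) (ϑ : Set (Fin J)) (r : ℝ) (y : PiLp 2 Z)

theorem weightedNormSq_relaxedBlockStep_sub_self :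
    weightedNormSq w (relaxedBlockStep T ϑ r y - y)
      = r ^ 2 * ∑ j, ϑ.indicator (fun j => w j * ‖T y j - y j‖ ^ 2) j := by
  rw [relaxedBlockStep, add_sub_cancel_left, weightedNormSq_smul, weightedNormSq]
  congr 1
  refine Finset.sum_congr rfl fun j _ => ?_
  by_cases hj : j ∈ ϑ
  · rw [Set.indicator_of_mem hj, PiLp.sub_apply, blockOperator_apply_of_mem T hj]
  · simp [hj, blockOperator_apply_of_notMem]

theorem weightedNormSq_relaxedBlockStep_sub (z : PiLp 2 Z) :
    weightedNormSq w (relaxedBlockStep T ϑ r y - z)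
      = weightedNormSq w (y - z)
        + r * ∑ j, ϑ.indicator (fun j => w j * (‖T y j - z j‖ ^ 2 - ‖y j - z j‖ ^ 2)) j
        - r * (1 - r) * ∑ j, ϑ.indicator (fun j => w j * ‖T y j - y j‖ ^ 2) j := by
  simp only [weightedNormSq, Finset.mul_sum, ← Finset.sum_add_distrib, ← Finset.sum_sub_distrib]
  refine Finset.sum_congr rfl fun j _ => ?_
  simp only [relaxedBlockStep, PiLp.add_apply, PiLp.sub_apply, PiLp.smul_apply]
  by_cases hj : j ∈ ϑ
  · rw [Set.indicator_of_mem hj, Set.indicator_of_mem hj, blockOperator_apply_of_mem T hj,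
      add_sub_right_comm, norm_add_smul_sq_eq, add_comm (y j - z j), sub_add_sub_cancel]
    ring
  · simp [hj, blockOperator_apply_of_notMem]

end BlockStep

/-! ### Parameters of the inertial iteration -/

/-- The coefficient of the squared increment in the Lyapunov function, for the inertial parameter
`a` and the relaxation parameter `r`. -/
def inertiaCoeff (δ a r : ℝ) : ℝ := a * (1 + a) + a * (1 - r) * δ

/-- The conditions on the inertial parameters `a` and the relaxation parameters `r`; the indices
are shifted so that the sequences start at `0`. -/
structure InertialParameters (a r : ℕ → ℝ) (α ρ θ δ : ℝ) : Prop where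
  mono : Monotone a
  nonneg : ∀ n, 0 ≤ a n
  le : ∀ n, a n ≤ α
  lt_one : α < 1
  rho_pos : 0 < ρ
  theta_pos : 0 < θ
  delta_pos : 0 < δ
  rho_le : ∀ n, ρ ≤ r n
  r_lt : ∀ n, r n <
    (δ - α * (α * (1 + α) + α * δ + θ)) / (δ * (1 + α * (1 + α) + α * δ + θ))

namespace InertialParameters

variable {a r : ℕ → ℝ} {α ρ θ δ : ℝ}

theorem alpha_nonneg (h : InertialParameters a r α ρ θ δ) : 0 ≤ α := (h.nonneg 0).trans (h.le 0)

theorem le_one (h : InertialParameters a r α ρ θ δ) (n : ℕ) : a n ≤ 1 :=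
  (h.le n).trans h.lt_one.le

theorem exists_tendsto (h : InertialParameters a r α ρ θ δ) : ∃ l, Tendsto a atTop (𝓝 l) :=
  ⟨_, tendsto_atTop_ciSup h.mono ⟨α, Set.forall_mem_range.2 h.le⟩⟩

theorem r_pos (h : InertialParameters a r α ρ θ δ) (n : ℕ) : 0 < r n :=
  h.rho_pos.trans_le (h.rho_le n)

theorem mul_le_one_sub_mul (h : InertialParameters a r α ρ θ δ) (n : ℕ) :
    (α * (1 + α) + α * δ + θ) * (a n + δ * r n) ≤ (1 - r n) * δ := by
  have hα := h.alpha_nonneg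
  have hδ := h.delta_pos
  have hθ := h.theta_pos
  have hr := (lt_div_iff₀ (by positivity)).1 (h.r_lt n)
  have ha : a n * (α * (1 + α) + α * δ + θ) ≤ α * (α * (1 + α) + α * δ + θ) :=
    mul_le_mul_of_nonneg_right (h.le n) (by positivity)
  linarith

theorem r_le_one (h : InertialParameters a r α ρ θ δ) (n : ℕ) : r n ≤ 1 := by
  have hα := h.alpha_nonneg
  have hδ := h.delta_pos
  have hθ := h.theta_pos
  have ha := h.nonneg n
  have hr := h.r_pos n
  have hpos : 0 ≤ (1 - r n) * δ := le_trans (by positivity) (h.mul_le_one_sub_mul n)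
  exact sub_nonneg.1 (nonneg_of_mul_nonneg_left hpos hδ)

theorem inertiaCoeff_nonneg (h : InertialParameters a r α ρ θ δ) (n : ℕ) :
    0 ≤ inertiaCoeff δ (a n) (r n) := by
  have ha := h.nonneg n
  have hr := sub_nonneg.2 (h.r_le_one n)
  have hδ := h.delta_pos
  unfold inertiaCoeff
  positivity

theorem inertiaCoeff_le (h : InertialParameters a r α ρ θ δ) (n : ℕ) :
    inertiaCoeff δ (a n) (r n) ≤ α * (1 + α) + α * δ := by
  have ha := h.nonneg n
  have hα := h.alpha_nonneg
  have haα := h.le n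
  have hδ := h.delta_pos
  have hr : a n * (1 - r n) ≤ a n := mul_le_of_le_one_right ha (by linarith [h.r_pos n])
  unfold inertiaCoeff
  gcongr
  exact hr.trans haα

theorem inertiaCoeff_add_le (h : InertialParameters a r α ρ θ δ) (m n : ℕ) :
    inertiaCoeff δ (a m) (r m) + θ ≤ (1 - r n) * δ / (a n + δ * r n) := by
  have hpos : 0 < a n + δ * r n :=
    add_pos_of_nonneg_of_pos (h.nonneg n) (mul_pos h.delta_pos (h.r_pos n))
  rw [le_div_iff₀ hpos]
  exact (mul_le_mul_of_nonneg_right (by linarith [h.inertiaCoeff_le m]) hpos.le).trans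
    (h.mul_le_one_sub_mul n)

end InertialParameters

section EnergyStep

variable {J : ℕ} {Z : Fin J → Type*} [∀ j, NormedAddCommGroup (Z j)]
  [∀ j, InnerProductSpace ℝ (Z j)] {w : Fin J → ℝ}

theorem weightedNormSq_inertialStep_sub_le (hw : ∀ j, 0 ≤ w j) (T : PiLp 2 Z → PiLp 2 Z)
    (ϑ : Set (Fin J)) {a r δ : ℝ} (ha : 0 ≤ a) (hr0 : 0 < r) (hr1 : r ≤ 1) (hδ : 0 < δ)
    {u v y x z : PiLp 2 Z} (hy : y = v + a • (v - u)) (hx : x = relaxedBlockStep T ϑ r y) :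
    weightedNormSq w (x - z) ≤ (1 + a) * weightedNormSq w (v - z) - a * weightedNormSq w (u - z)
      + inertiaCoeff δ a r * weightedNormSq w (v - u)
      - (1 - r) * δ / (a + δ * r) * weightedNormSq w (x - v)
      + r * ∑ j, ϑ.indicator (fun j => w j * (‖T y j - z j‖ ^ 2 - ‖y j - z j‖ ^ 2)) j := by
  set Q := ∑ j, ϑ.indicator (fun j => w j * ‖T y j - y j‖ ^ 2) j
  have hstep : r ^ 2 * Q = weightedNormSq w (x - v - a • (v - u)) := by
    rw [← weightedNormSq_relaxedBlockStep_sub_self, ← hx, sub_sub, hy]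
  have hQ : (1 - r) * δ / (a + δ * r) * weightedNormSq w (x - v)
      - a * (1 - r) * δ * weightedNormSq w (v - u) ≤ r * (1 - r) * Q :=
    calc (1 - r) * δ / (a + δ * r) * weightedNormSq w (x - v)
          - a * (1 - r) * δ * weightedNormSq w (v - u)
        = (1 - r) / r * (δ * r / (a + δ * r) * weightedNormSq w (x - v)
            - a * (δ * r) * weightedNormSq w (v - u)) := by field_simp
      _ ≤ (1 - r) / r * (r ^ 2 * Q) := by
          rw [hstep]
          exact mul_le_mul_of_nonneg_left
            (le_weightedNormSq_sub_smul hw _ _ ha (mul_pos hδ hr0))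
            (div_nonneg (sub_nonneg.2 hr1) hr0.le)
      _ = r * (1 - r) * Q := by field_simp
  have hdist : weightedNormSq w (y - z) = (1 + a) * weightedNormSq w (v - z)
      - a * weightedNormSq w (u - z) + a * (1 + a) * weightedNormSq w (v - u) := by
    rw [hy, weightedNormSq_add_smul_sub_sub]
  rw [hx, weightedNormSq_relaxedBlockStep_sub, hdist, ← hx, inertiaCoeff]
  linarith

end EnergyStep

/-! ### Supermartingales with inertia -/

theorem ae_tendsto_zero_of_summable_integral {Ω : Type*} [MeasurableSpace Ω] {P : Measure Ω}
    {f : ℕ → Ω → ℝ} (hf : ∀ n, Integrable (f n) P) (hf0 : ∀ n ω, 0 ≤ f n ω)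
    (hsum : Summable fun n => ∫ ω, f n ω ∂P) :
    ∀ᵐ ω ∂P, Tendsto (fun n => f n ω) atTop (𝓝 0) := by
  have hmeas (n : ℕ) : AEMeasurable (fun ω => ENNReal.ofReal (f n ω)) P :=
    (hf n).aestronglyMeasurable.aemeasurable.ennreal_ofReal
  have hfin : ∫⁻ ω, ∑' n, ENNReal.ofReal (f n ω) ∂P ≠ ⊤ := by
    simp_rw [lintegral_tsum hmeas,
      ← ofReal_integral_eq_lintegral_ofReal (hf _) (ae_of_all _ (hf0 _))]
    exact hsum.tsum_ofReal_ne_top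
  filter_upwards [ae_lt_top' (.tsum hmeas) hfin] with ω hω
  have hlim := (ENNReal.tendsto_toReal ENNReal.zero_ne_top).comp
    (ENNReal.tendsto_atTop_zero_of_tsum_ne_top hω.ne)
  exact hlim.congr fun n => ENNReal.toReal_ofReal (hf0 n ω)

section InertialSupermartingale

variable {Ω : Type*} [mΩ : MeasurableSpace Ω]

/-- The Lyapunov function of an inertial process: `φ` stands for the squared distance to a
solution and `d` for the squared increment. -/
def inertialEnergy (a c : ℕ → ℝ) (φ d : ℕ → Ω → ℝ) (n : ℕ) (ω : Ω) : ℝ :=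
  φ (n + 1) ω - a n * φ n ω + c n * d n ω

/-- A pair of nonnegative integrable processes whose inertial energy is adapted and decreases in
conditional mean by at least `θ` times the next value of `d`. -/
structure IsInertialSupermartingale (φ d : ℕ → Ω → ℝ) (a c : ℕ → ℝ) (θ : ℝ)
    (ℱ : Filtration ℕ mΩ) (P : Measure Ω) : Prop where
  nonneg_dist : ∀ n ω, 0 ≤ φ n ω
  nonneg_incr : ∀ n ω, 0 ≤ d n ω
  integrable_dist : ∀ n, Integrable (φ n) P
  integrable_incr : ∀ n, Integrable (d n) P
  adapted : StronglyAdapted ℱ (inertialEnergy a c φ d)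
  condExp_le : ∀ n,
    P[fun ω => inertialEnergy a c φ d (n + 1) ω + θ * d (n + 1) ω | ℱ n]
      ≤ᵐ[P] inertialEnergy a c φ d n

namespace IsInertialSupermartingale

variable {φ d : ℕ → Ω → ℝ} {a c : ℕ → ℝ} {α θ C : ℝ} {ℱ : Filtration ℕ mΩ} {P : Measure Ω}

theorem integrable_energy (h : IsInertialSupermartingale φ d a c θ ℱ P) (n : ℕ) :
    Integrable (inertialEnergy a c φ d n) P :=
  ((h.integrable_dist (n + 1)).sub ((h.integrable_dist n).const_mul (a n))).add
    ((h.integrable_incr n).const_mul (c n))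

theorem sub_mul_le_energy (h : IsInertialSupermartingale φ d a c θ ℱ P) (ha : ∀ n, a n ≤ α)
    (hc : ∀ n, 0 ≤ c n) (n : ℕ) (ω : Ω) :
    φ (n + 1) ω - α * φ n ω ≤ inertialEnergy a c φ d n ω := by
  have hdist := mul_le_mul_of_nonneg_right (ha n) (h.nonneg_dist n ω)
  have hincr := mul_nonneg (hc n) (h.nonneg_incr n ω)
  unfold inertialEnergy
  linarith

theorem integral_sub_mul_le_energy (h : IsInertialSupermartingale φ d a c θ ℱ P)
    (ha : ∀ n, a n ≤ α) (hc : ∀ n, 0 ≤ c n) (n : ℕ) :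
    ∫ ω, φ (n + 1) ω ∂P - α * ∫ ω, φ n ω ∂P ≤ ∫ ω, inertialEnergy a c φ d n ω ∂P := by
  rw [← integral_const_mul,
    ← integral_sub (h.integrable_dist _) ((h.integrable_dist n).const_mul α)]
  exact integral_mono ((h.integrable_dist _).sub ((h.integrable_dist n).const_mul α))
    (h.integrable_energy n) (h.sub_mul_le_energy ha hc n)

theorem integral_norm_energy_le (h : IsInertialSupermartingale φ d a c θ ℱ P)
    (hα1 : α ≤ 1) (ha : ∀ n, a n ≤ α) (hc : ∀ n, 0 ≤ c n) (n : ℕ) :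
    ∫ ω, ‖inertialEnergy a c φ d n ω‖ ∂P
      ≤ ∫ ω, inertialEnergy a c φ d n ω ∂P + 2 * ∫ ω, φ n ω ∂P := by
  have hint := (h.integrable_dist n).const_mul 2
  rw [← integral_const_mul, ← integral_add (h.integrable_energy n) hint]
  refine integral_mono (h.integrable_energy n).norm ((h.integrable_energy n).add hint) fun ω => ?_
  have hlower : -φ n ω ≤ inertialEnergy a c φ d n ω := by
    linarith [h.sub_mul_le_energy (fun n => (ha n).trans hα1) hc n ω, h.nonneg_dist (n + 1) ω]
  rw [Real.norm_eq_abs, abs_le]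
  constructor <;> linarith [h.nonneg_dist n ω]

variable [IsFiniteMeasure P]

theorem integral_energy_succ_add_le (h : IsInertialSupermartingale φ d a c θ ℱ P) (n : ℕ) :
    ∫ ω, inertialEnergy a c φ d (n + 1) ω ∂P + θ * ∫ ω, d (n + 1) ω ∂P
      ≤ ∫ ω, inertialEnergy a c φ d n ω ∂P := by
  rw [← integral_const_mul, ← integral_add (h.integrable_energy _)
    ((h.integrable_incr _).const_mul θ), ← integral_condExp (ℱ.le n)]
  exact integral_mono_ae integrable_condExp (h.integrable_energy n) (h.condExp_le n)

theorem integral_energy_le (h : IsInertialSupermartingale φ d a c θ ℱ P) (hθ : 0 ≤ θ) (n : ℕ) :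
    ∫ ω, inertialEnergy a c φ d n ω ∂P ≤ ∫ ω, inertialEnergy a c φ d 0 ω ∂P := by
  refine antitone_nat_of_succ_le (f := fun n => ∫ ω, inertialEnergy a c φ d n ω ∂P)
    (fun n => ?_) n.zero_le
  have hincr := mul_nonneg hθ (integral_nonneg (μ := P) (h.nonneg_incr (n + 1)))
  linarith [h.integral_energy_succ_add_le n]

theorem exists_integral_dist_le (h : IsInertialSupermartingale φ d a c θ ℱ P) (hθ : 0 ≤ θ)
    (hα0 : 0 ≤ α) (hα1 : α < 1) (ha : ∀ n, a n ≤ α) (hc : ∀ n, 0 ≤ c n) :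
    ∃ C, ∀ n, ∫ ω, φ n ω ∂P ≤ C :=
  exists_forall_le_of_le_mul_add (c := ∫ ω, inertialEnergy a c φ d 0 ω ∂P) hα0 hα1 fun n => by
    linarith [h.integral_sub_mul_le_energy ha hc n, h.integral_energy_le hθ n]

theorem summable_integral_incr (h : IsInertialSupermartingale φ d a c θ ℱ P) (hθ : 0 < θ)
    (hα0 : 0 ≤ α) (hα1 : α < 1) (ha : ∀ n, a n ≤ α) (hc : ∀ n, 0 ≤ c n) :
    Summable fun n => ∫ ω, d n ω ∂P := by
  obtain ⟨C, hC⟩ := h.exists_integral_dist_le hθ.le hα0 hα1 ha hc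
  have htelescope (n : ℕ) : ∫ ω, inertialEnergy a c φ d n ω ∂P
      + θ * ∑ i ∈ Finset.range n, ∫ ω, d (i + 1) ω ∂P
      ≤ ∫ ω, inertialEnergy a c φ d 0 ω ∂P := by
    induction n with
    | zero => simp
    | succ n ih =>
      rw [Finset.sum_range_succ]
      linarith [h.integral_energy_succ_add_le n]
  refine (summable_nat_add_iff 1).1 (summable_of_sum_range_le
    (c := (∫ ω, inertialEnergy a c φ d 0 ω ∂P + α * C) / θ)
    (fun n => integral_nonneg (h.nonneg_incr _)) fun n => ?_)
  rw [le_div_iff₀' hθ]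
  have hdist : 0 ≤ ∫ ω, φ (n + 1) ω ∂P := integral_nonneg (h.nonneg_dist _)
  linarith [htelescope n, h.integral_sub_mul_le_energy ha hc n,
    mul_le_mul_of_nonneg_left (hC n) hα0]

theorem ae_tendsto_incr (h : IsInertialSupermartingale φ d a c θ ℱ P) (hθ : 0 < θ)
    (hα0 : 0 ≤ α) (hα1 : α < 1) (ha : ∀ n, a n ≤ α) (hc : ∀ n, 0 ≤ c n) :
    ∀ᵐ ω ∂P, Tendsto (fun n => d n ω) atTop (𝓝 0) :=
  ae_tendsto_zero_of_summable_integral h.integrable_incr h.nonneg_incr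
    (h.summable_integral_incr hθ hα0 hα1 ha hc)

theorem supermartingale_energy (h : IsInertialSupermartingale φ d a c θ ℱ P) (hθ : 0 ≤ θ) :
    Supermartingale (inertialEnergy a c φ d) ℱ P := by
  refine supermartingale_nat h.adapted h.integrable_energy fun n =>
    (condExp_mono (h.integrable_energy _)
      ((h.integrable_energy _).add ((h.integrable_incr _).const_mul θ)) ?_).trans (h.condExp_le n)
  exact ae_of_all _ fun ω => le_add_of_nonneg_right (mul_nonneg hθ (h.nonneg_incr _ ω))

theorem ae_exists_tendsto_energy (h : IsInertialSupermartingale φ d a c θ ℱ P) (hθ : 0 ≤ θ)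
    (hα0 : 0 ≤ α) (hα1 : α < 1) (ha : ∀ n, a n ≤ α) (hc : ∀ n, 0 ≤ c n) :
    ∀ᵐ ω ∂P, ∃ l, Tendsto (fun n => inertialEnergy a c φ d n ω) atTop (𝓝 l) := by
  obtain ⟨C, hC⟩ := h.exists_integral_dist_le hθ hα0 hα1 ha hc
  have hbdd (n : ℕ) : eLpNorm ((-inertialEnergy a c φ d) n) 1 P
      ≤ (∫ ω, inertialEnergy a c φ d 0 ω ∂P + 2 * C).toNNReal := by
    rw [Pi.neg_apply, eLpNorm_neg, eLpNorm_one_eq_lintegral_enorm,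
      ← ofReal_integral_norm_eq_lintegral_enorm (h.integrable_energy n)]
    refine ENNReal.ofReal_le_ofReal ((h.integral_norm_energy_le hα1.le ha hc n).trans ?_)
    linarith [h.integral_energy_le hθ n, hC n]
  filter_upwards [(h.supermartingale_energy hθ).neg.exists_ae_tendsto_of_bdd hbdd] with ω ⟨l, hl⟩
  exact ⟨-l, hl.neg.congr fun n => neg_neg _⟩

theorem ae_exists_tendsto_dist (h : IsInertialSupermartingale φ d a c θ ℱ P) (hθ : 0 < θ)
    (hα1 : α < 1) (ha0 : ∀ n, 0 ≤ a n) (ha : ∀ n, a n ≤ α) (ha_lim : ∃ l, Tendsto a atTop (𝓝 l))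
    (hc0 : ∀ n, 0 ≤ c n) (hcC : ∀ n, c n ≤ C) :
    ∀ᵐ ω ∂P, ∃ l, Tendsto (fun n => φ n ω) atTop (𝓝 l) := by
  have hα0 := (ha0 0).trans (ha 0)
  obtain ⟨aLim, haLim⟩ := ha_lim
  filter_upwards [h.ae_exists_tendsto_energy hθ.le hα0 hα1 ha hc0,
    h.ae_tendsto_incr hθ hα0 hα1 ha hc0] with ω ⟨l, hl⟩ hd
  have hcd : Tendsto (fun n => c n * d n ω) atTop (𝓝 0) :=
    squeeze_zero (fun n => mul_nonneg (hc0 n) (h.nonneg_incr n ω))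
      (fun n => mul_le_mul_of_nonneg_right (hcC n) (h.nonneg_incr n ω))
      (by simpa using hd.const_mul C)
  exact exists_tendsto_of_tendsto_sub_mul ha0 ha hα1 haLim
    ((hl.sub hcd).congr fun n => add_sub_cancel_right _ _)

end IsInertialSupermartingale

end InertialSupermartingale

/-! ### Random selections of blocks -/

section Selection

variable {ι Ω : Type*}

theorem measurableSet_mem_of_measurable {_ : MeasurableSpace Ω} {ξ : Ω → Set ι}
    (hξ : Measurable ξ) (j : ι) : MeasurableSet {ω | j ∈ ξ ω} :=
  measurableSet_setOfPred.2 ((measurable_set_mem j).comp hξ)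

variable [mΩ : MeasurableSpace Ω] {P : Measure Ω}

theorem integrable_selectedSum [Fintype ι] {ξ : Ω → Set ι} (hξ : Measurable ξ) {c : ι → Ω → ℝ}
    (hc : ∀ j, Integrable (c j) P) :
    Integrable (fun ω => ∑ j, (ξ ω).indicator (fun j => c j ω) j) P :=
  integrable_finsetSum _ fun j _ => ((hc j).indicator (measurableSet_mem_of_measurable hξ j)).congr
    (ae_of_all _ fun _ => rfl)

theorem condExp_selectedSum [Fintype ι] [IsFiniteMeasure P] {m : MeasurableSpace Ω}
    {ξ : Ω → Set ι} (hξ : Measurable[mΩ] ξ) {q : ι → ℝ} (hq : ∀ j, q j ≠ 0)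
    (hξ_condExp : ∀ j, P[{ω | j ∈ ξ ω}.indicator 1 | m] =ᵐ[P] fun _ => q j)
    {c : ι → Ω → ℝ} (hc : ∀ j, StronglyMeasurable[m] (c j)) (hc_int : ∀ j, Integrable (c j) P) :
    P[fun ω => ∑ j, (ξ ω).indicator (fun j => (q j)⁻¹ * c j ω) j | m]
      =ᵐ[P] fun ω => ∑ j, c j ω := by
  have hterm (j : ι) : P[fun ω => (ξ ω).indicator (fun j => (q j)⁻¹ * c j ω) j | m]
      =ᵐ[P] c j := by
    have hprod : (fun ω => (ξ ω).indicator (fun j => (q j)⁻¹ * c j ω) j)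
        = (fun ω => (q j)⁻¹ * c j ω) * {ω | j ∈ ξ ω}.indicator 1 := by
      ext ω
      by_cases hj : j ∈ ξ ω <;> simp [hj]
    have hmeas := measurableSet_mem_of_measurable hξ j
    have hint : Integrable ((fun ω => (q j)⁻¹ * c j ω) * {ω | j ∈ ξ ω}.indicator 1) P :=
      hprod ▸ ((hc_int j).const_mul (q j)⁻¹).indicator hmeas
    rw [hprod]
    filter_upwards [condExp_mul_of_stronglyMeasurable_left ((hc j).const_mul _) hint
      ((integrable_const 1).indicator hmeas), hξ_condExp j] with ω hmul hcond
    rw [hmul, Pi.mul_apply, hcond]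
    field_simp [hq j]
  have hsum := condExp_finsetSum (μ := P) (s := Finset.univ)
    (f := fun j ω => (ξ ω).indicator (fun j => (q j)⁻¹ * c j ω) j)
    (fun j _ => ((hc_int j).const_mul (q j)⁻¹).indicator (measurableSet_mem_of_measurable hξ j)) m
  filter_upwards [hsum, ae_all_iff.2 hterm] with ω hω hj
  rw [← Finset.sum_fn, hω, Finset.sum_apply]
  exact Finset.sum_congr rfl fun j _ => hj j

/-- A sequence of random sets of blocks, revealed one at a time along the filtration `ℱ`: given
`ℱ n`, the set `ζ n` contains the block `j` with the constant conditional probability `q j > 0`. -/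
structure IsBlockSelection (ζ : ℕ → Ω → Set ι) (q : ι → ℝ) (ℱ : Filtration ℕ mΩ)
    (P : Measure Ω) : Prop where
  measurable : ∀ n, Measurable[ℱ (n + 1)] (ζ n)
  condExp : ∀ n j, P[{ω | j ∈ ζ n ω}.indicator 1 | ℱ n] =ᵐ[P] fun _ => q j
  pos : ∀ j, 0 < q j

/-- The filtration whose `n`-th member is generated by the selections `ζ i` with `i < n`. -/
def pastFiltration (ζ : ℕ → Ω → Set ι) (hζ : ∀ n, Measurable (ζ n)) : Filtration ℕ mΩ where
  seq n := ⨆ i ∈ Set.Iio n, MeasurableSpace.comap (ζ i) inferInstance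
  mono' _ _ hmn := biSup_mono fun _ hi => lt_of_lt_of_le hi hmn
  le' _ := iSup₂_le fun i _ => (hζ i).comap_le

namespace IsBlockSelection

variable {ζ : ℕ → Ω → Set ι} {q : ι → ℝ} {ℱ : Filtration ℕ mΩ}

theorem measurable_ambient (h : IsBlockSelection ζ q ℱ P) (n : ℕ) : Measurable (ζ n) :=
  (h.measurable n).mono (ℱ.le _) le_rfl

theorem le_one [IsProbabilityMeasure P] (h : IsBlockSelection ζ q ℱ P) (j : ι) : q j ≤ 1 := by
  have hle : P[{ω | j ∈ ζ 0 ω}.indicator (1 : Ω → ℝ) | ℱ 0] ≤ᵐ[P] P[fun _ => (1 : ℝ) | ℱ 0] :=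
    condExp_mono ((integrable_const 1).indicator
      (measurableSet_mem_of_measurable (h.measurable_ambient 0) j)) (integrable_const 1)
      (ae_of_all _ (Set.indicator_le_self' fun _ _ => zero_le_one))
  rw [condExp_const (ℱ.le 0)] at hle
  obtain ⟨ω, hω, hqω⟩ := (hle.and (h.condExp 0 j)).exists
  rwa [hqω] at hω

theorem one_le_inv [IsProbabilityMeasure P] (h : IsBlockSelection ζ q ℱ P) (j : ι) :
    1 ≤ (q j)⁻¹ :=
  (one_le_inv₀ (h.pos j)).2 (h.le_one j)

theorem of_iIndepFun [IsProbabilityMeasure P] (hζ : ∀ n, Measurable (ζ n))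
    (hindep : iIndepFun ζ P) (hq : ∀ n j, P.real {ω | j ∈ ζ n ω} = q j) (hq_pos : ∀ j, 0 < q j) :
    IsBlockSelection ζ q (pastFiltration ζ hζ) P where
  measurable n := measurable_iff_comap_le.2 <| le_iSup₂ (f := fun i (_ : i ∈ Set.Iio (n + 1)) =>
    MeasurableSpace.comap (ζ i) inferInstance) n n.lt_succ_self
  condExp n j := by
    have hindep_past :
        Indep (MeasurableSpace.comap (ζ n) inferInstance) (pastFiltration ζ hζ n) P := by
      have h := indep_iSup_of_disjoint (fun i => (hζ i).comap_le) hindep.iIndep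
        (show Disjoint {n} (Set.Iio n) by simp)
      rwa [iSup_singleton] at h
    have hmeas : StronglyMeasurable[MeasurableSpace.comap (ζ n) inferInstance]
        ({ω | j ∈ ζ n ω}.indicator (1 : Ω → ℝ)) :=
      stronglyMeasurable_one.indicator
        (measurableSet_mem_of_measurable (comap_measurable (ζ n)) j)
    rw [← hq n j, ← integral_indicator_one (measurableSet_mem_of_measurable (hζ n) j)]
    exact condExp_indep_eq (hζ n).comap_le ((pastFiltration ζ hζ).le n) hmeas hindep_past
  pos := hq_pos

theorem of_identDistrib [IsProbabilityMeasure P] (hζ : ∀ n, Measurable (ζ n))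
    (hindep : iIndepFun ζ P) {ξ : Ω → Set ι} (hident : ∀ n, IdentDistrib (ζ n) ξ P P)
    (hpos : ∀ j, ∃ ϑ, j ∈ ϑ ∧ 0 < P {ω | ξ ω = ϑ}) :
    IsBlockSelection ζ (fun j => P.real {ω | j ∈ ξ ω}) (pastFiltration ζ hζ) P := by
  refine of_iIndepFun hζ hindep (fun n j => ?_) fun j => ?_
  · exact congrArg ENNReal.toReal ((hident n).measure_mem_eq
      (measurableSet_setOfPred.2 (measurable_set_mem j)))
  · obtain ⟨ϑ, hj, hϑ⟩ := hpos j
    have hle : P {ω | ξ ω = ϑ} ≤ P {ω | j ∈ ξ ω} := measure_mono fun ω hω => hω.symm.subset hj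
    exact ENNReal.toReal_pos (hϑ.trans_le hle).ne' (measure_ne_top _ _)

end IsBlockSelection

end Selection

/-! ### The random iteration -/

theorem memLp_comp_of_lipschitzWith {Ω E F : Type*} [MeasurableSpace Ω] {P : Measure Ω}
    [IsFiniteMeasure P] [NormedAddCommGroup E] [NormedAddCommGroup F] {K : NNReal} {p : ENNReal}
    {g : E → F} (hg : LipschitzWith K g) {u : Ω → E} (hu : MemLp u p P) :
    MemLp (fun ω => g (u ω)) p P := by
  have hcentred : MemLp (fun ω => g (u ω) - g 0) p P :=
    (hg.sub (.const (g 0))).comp_memLp (sub_self _) hu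
  simpa only [Pi.add_def, sub_add_cancel] using hcentred.add (memLp_const (g 0))

theorem tendsto_zero_of_norm_sq_le {E : Type*} [SeminormedAddCommGroup E] {u : ℕ → E} {f : ℕ → ℝ}
    (h : ∀ n, ‖u n‖ ^ 2 ≤ f n) (hf : Tendsto f atTop (𝓝 0)) : Tendsto u atTop (𝓝 0) :=
  squeeze_zero_norm (fun n => Real.le_sqrt_of_sq_le (h n)) (by simpa using hf.sqrt)

theorem tendsto_apply_sub_self_of_tendsto_sub {E : Type*} [SeminormedAddCommGroup E] {T : E → E}
    (hT : LipschitzWith 1 T) {x y : ℕ → E} (hy : Tendsto (fun n => T (y n) - y n) atTop (𝓝 0))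
    (hxy : Tendsto (fun n => y n - x n) atTop (𝓝 0)) :
    Tendsto (fun n => T (x n) - x n) atTop (𝓝 0) := by
  have hTxy : Tendsto (fun n => T (y n) - T (x n)) atTop (𝓝 0) :=
    squeeze_zero_norm (fun n => by simpa using hT.norm_sub_le (y n) (x n))
      (tendsto_zero_iff_norm_tendsto_zero.1 hxy)
  simpa using ((hy.sub hTxy).add hxy).congr fun n => show _ = T (x n) - x n by abel

section Iteration

variable {J : ℕ} {Z : Fin J → Type*} [∀ j, NormedAddCommGroup (Z j)] {Ω : Type*}

theorem stronglyMeasurable_blockOperator {m : MeasurableSpace Ω} {T : PiLp 2 Z → PiLp 2 Z}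
    (hT : Continuous T) {ξ : Ω → Set (Fin J)} (hξ : Measurable ξ) {y : Ω → PiLp 2 Z}
    (hy : StronglyMeasurable y) : StronglyMeasurable fun ω => blockOperator T (ξ ω) (y ω) := by
  classical
  have hsum (ω : Ω) : blockOperator T (ξ ω) (y ω)
      = ∑ ϑ : Set (Fin J), if ξ ω = ϑ then blockOperator T ϑ (y ω) else 0 := by simp
  simp only [hsum]
  exact Finset.stronglyMeasurable_fun_sum _ fun ϑ _ =>
    StronglyMeasurable.ite (hξ (measurableSet_singleton ϑ))
      ((continuous_blockOperator hT ϑ).comp_stronglyMeasurable hy) stronglyMeasurable_const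

theorem stronglyMeasurable_weightedNormSq {_ : MeasurableSpace Ω} (w : Fin J → ℝ)
    {u : Ω → PiLp 2 Z} (hu : StronglyMeasurable u) :
    StronglyMeasurable fun ω => weightedNormSq w (u ω) :=
  (continuous_weightedNormSq w).comp_stronglyMeasurable hu

theorem stronglyMeasurable_norm_apply_sq {_ : MeasurableSpace Ω} {u : Ω → PiLp 2 Z}
    (hu : StronglyMeasurable u) (j : Fin J) : StronglyMeasurable fun ω => ‖u ω j‖ ^ 2 :=
  ((PiLp.continuous_apply 2 _ j).comp_stronglyMeasurable hu).norm.pow 2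

/-- The weighted squared distances of the iterates `x n` to the point `z`. -/
def weightedDistSq (w : Fin J → ℝ) (x : ℕ → Ω → PiLp 2 Z) (z : PiLp 2 Z) (n : ℕ) (ω : Ω) : ℝ :=
  weightedNormSq w (x n ω - z)

/-- The weighted squared increments of the iterates `x n`. -/
def weightedIncrSq (w : Fin J → ℝ) (x : ℕ → Ω → PiLp 2 Z) (n : ℕ) (ω : Ω) : ℝ :=
  weightedNormSq w (x (n + 1) ω - x n ω)

variable [∀ j, InnerProductSpace ℝ (Z j)]

/-- The extrapolated point from which the step to `x (n + 2)` starts. -/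
def extrapolation (a : ℕ → ℝ) (x : ℕ → Ω → PiLp 2 Z) (n : ℕ) (ω : Ω) : PiLp 2 Z :=
  x (n + 1) ω + a n • (x (n + 1) ω - x n ω)

theorem norm_extrapolation_sub_sq_le {w : Fin J → ℝ} (hw : ∀ j, 1 ≤ w j) {a : ℕ → ℝ} {n : ℕ}
    (ha0 : 0 ≤ a n) (ha1 : a n ≤ 1) (x : ℕ → Ω → PiLp 2 Z) (ω : Ω) :
    ‖extrapolation a x n ω - x (n + 1) ω‖ ^ 2 ≤ weightedIncrSq w x n ω := by
  rw [extrapolation, add_sub_cancel_left, norm_smul_sq]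
  exact (mul_le_of_le_one_left (sq_nonneg _) (pow_le_one₀ ha0 ha1)).trans
    (norm_sq_le_weightedNormSq hw _)

/-- The excess of `‖T y j - z j‖ ^ 2` over `‖y j - z j‖ ^ 2` in the block `j`, where `y` is the
extrapolated point; for a nonexpansive `T` fixing `z` its sum over all blocks is nonpositive. -/
def blockExcess (T : PiLp 2 Z → PiLp 2 Z) (a : ℕ → ℝ) (x : ℕ → Ω → PiLp 2 Z) (z : PiLp 2 Z)
    (n : ℕ) (j : Fin J) (ω : Ω) : ℝ :=
  ‖T (extrapolation a x n ω) j - z j‖ ^ 2 - ‖extrapolation a x n ω j - z j‖ ^ 2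

theorem sum_blockExcess_nonpos {T : PiLp 2 Z → PiLp 2 Z} (hT : LipschitzWith 1 T) {z : PiLp 2 Z}
    (hz : T z = z) (a : ℕ → ℝ) (x : ℕ → Ω → PiLp 2 Z) (n : ℕ) (ω : Ω) :
    ∑ j, blockExcess T a x z n j ω ≤ 0 := by
  have hnonexp : ‖T (extrapolation a x n ω) - z‖ ≤ ‖extrapolation a x n ω - z‖ := by
    simpa [hz] using hT.norm_sub_le (extrapolation a x n ω) z
  simpa only [blockExcess, Finset.sum_sub_distrib, ← PiLp.sub_apply, ← PiLp.norm_sq_eq_of_L2,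
    sub_nonpos] using pow_le_pow_left₀ (norm_nonneg _) hnonexp 2

variable [mΩ : MeasurableSpace Ω]

/-- The relaxed inertial block iteration with square-integrable initial points known at time `0`:
`ζ n` is the set of blocks updated when passing from `x (n + 1)` to `x (n + 2)`. -/
structure IsInertialBlockIteration (T : PiLp 2 Z → PiLp 2 Z) (ζ : ℕ → Ω → Set (Fin J))
    (a r : ℕ → ℝ) (x : ℕ → Ω → PiLp 2 Z) (ℱ : Filtration ℕ mΩ) (P : Measure Ω) : Prop where
  stronglyMeasurable_zero : StronglyMeasurable[ℱ 0] (x 0)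
  stronglyMeasurable_one : StronglyMeasurable[ℱ 0] (x 1)
  memLp_zero : MemLp (x 0) 2 P
  memLp_one : MemLp (x 1) 2 P
  step : ∀ n ω, x (n + 2) ω = relaxedBlockStep T (ζ n ω) (r n) (extrapolation a x n ω)

namespace IsInertialBlockIteration

variable {T : PiLp 2 Z → PiLp 2 Z} {ζ : ℕ → Ω → Set (Fin J)} {a r : ℕ → ℝ}
  {x : ℕ → Ω → PiLp 2 Z} {ℱ : Filtration ℕ mΩ} {P : Measure Ω}

theorem stronglyMeasurable_pair (hx : IsInertialBlockIteration T ζ a r x ℱ P) (hT : Continuous T)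
    (hζ : ∀ n, Measurable[ℱ (n + 1)] (ζ n)) (n : ℕ) :
    StronglyMeasurable[ℱ n] (x n) ∧ StronglyMeasurable[ℱ n] (x (n + 1)) := by
  induction n with
  | zero => exact ⟨hx.stronglyMeasurable_zero, hx.stronglyMeasurable_one⟩
  | succ n ih =>
    have hx₀ := ih.1.mono (ℱ.mono n.le_succ)
    have hx₁ := ih.2.mono (ℱ.mono n.le_succ)
    have hy : StronglyMeasurable[ℱ (n + 1)] (extrapolation a x n) :=
      hx₁.add ((hx₁.sub hx₀).const_smul (a n))
    have hblock := stronglyMeasurable_blockOperator hT (hζ n) hy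
    rw [show x (n + 2) = _ from funext (hx.step n)]
    exact ⟨hx₁, hy.add ((hblock.sub hy).const_smul (r n))⟩

theorem stronglyMeasurable_extrapolation (hx : IsInertialBlockIteration T ζ a r x ℱ P)
    (hT : Continuous T) (hζ : ∀ n, Measurable[ℱ (n + 1)] (ζ n)) (n : ℕ) :
    StronglyMeasurable[ℱ n] (extrapolation a x n) :=
  have ⟨hx₀, hx₁⟩ := hx.stronglyMeasurable_pair hT hζ n
  hx₁.add ((hx₁.sub hx₀).const_smul (a n))

theorem of_const [IsFiniteMeasure P] {x₀ x₁ : PiLp 2 Z} (h₀ : ∀ ω, x 0 ω = x₀)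
    (h₁ : ∀ ω, x 1 ω = x₁)
    (hstep : ∀ n ω, x (n + 2) ω = relaxedBlockStep T (ζ n ω) (r n) (extrapolation a x n ω)) :
    IsInertialBlockIteration T ζ a r x ℱ P where
  stronglyMeasurable_zero := funext h₀ ▸ stronglyMeasurable_const
  stronglyMeasurable_one := funext h₁ ▸ stronglyMeasurable_const
  memLp_zero := funext h₀ ▸ memLp_const x₀
  memLp_one := funext h₁ ▸ memLp_const x₁
  step := hstep

variable {α ρ θ δ : ℝ} {q w : Fin J → ℝ} {z : PiLp 2 Z}

theorem inertialEnergy_succ_add_le (hx : IsInertialBlockIteration T ζ a r x ℱ P)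
    (hpar : InertialParameters a r α ρ θ δ) (hw : ∀ j, 0 ≤ w j) (z : PiLp 2 Z) (n : ℕ) (ω : Ω) :
    inertialEnergy a (fun n => inertiaCoeff δ (a n) (r n)) (weightedDistSq w x z)
        (weightedIncrSq w x) (n + 1) ω + θ * weightedIncrSq w x (n + 1) ω
      ≤ inertialEnergy a (fun n => inertiaCoeff δ (a n) (r n)) (weightedDistSq w x z)
          (weightedIncrSq w x) n ω
        + r n * ∑ j, (ζ n ω).indicator (fun j => w j * blockExcess T a x z n j ω) j := by
  have hstep := weightedNormSq_inertialStep_sub_le (y := extrapolation a x n ω) (z := z) hw T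
    (ζ n ω) (hpar.nonneg n) (hpar.r_pos n) (hpar.r_le_one n) hpar.delta_pos rfl (hx.step n ω)
  have hdist := mul_le_mul_of_nonneg_right (hpar.mono n.le_succ)
    (weightedNormSq_nonneg hw (x (n + 1) ω - z))
  have hincr := mul_le_mul_of_nonneg_right (hpar.inertiaCoeff_add_le (n + 1) n)
    (weightedNormSq_nonneg hw (x (n + 2) ω - x (n + 1) ω))
  simp only [inertialEnergy, weightedDistSq, weightedIncrSq, blockExcess]
  linarith

theorem stronglyMeasurable_blockExcess (hx : IsInertialBlockIteration T ζ a r x ℱ P)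
    (hT : Continuous T) (hζ : ∀ n, Measurable[ℱ (n + 1)] (ζ n)) (z : PiLp 2 Z) (n : ℕ)
    (j : Fin J) : StronglyMeasurable[ℱ n] (blockExcess T a x z n j) :=
  have hy := hx.stronglyMeasurable_extrapolation hT hζ n
  have hz : StronglyMeasurable[ℱ n] fun _ : Ω => z := stronglyMeasurable_const
  (stronglyMeasurable_norm_apply_sq ((hT.comp_stronglyMeasurable hy).sub hz) j).sub
    (stronglyMeasurable_norm_apply_sq (hy.sub hz) j)

theorem stronglyAdapted_inertialEnergy (hx : IsInertialBlockIteration T ζ a r x ℱ P)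
    (hT : Continuous T) (hζ : ∀ n, Measurable[ℱ (n + 1)] (ζ n)) (w : Fin J → ℝ) (z : PiLp 2 Z)
    (c : ℕ → ℝ) :
    StronglyAdapted ℱ (inertialEnergy a c (weightedDistSq w x z) (weightedIncrSq w x)) := fun n =>
  have ⟨hx₀, hx₁⟩ := hx.stronglyMeasurable_pair hT hζ n
  have hdist {u : Ω → PiLp 2 Z} (hu : StronglyMeasurable[ℱ n] u) :=
    stronglyMeasurable_weightedNormSq w (hu.sub (stronglyMeasurable_const (b := z)))
  ((hdist hx₁).sub ((hdist hx₀).const_mul (a n))).add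
    ((stronglyMeasurable_weightedNormSq w (hx₁.sub hx₀)).const_mul (c n))

theorem sum_indicator_residual_le (hx : IsInertialBlockIteration T ζ a r x ℱ P)
    (hpar : InertialParameters a r α ρ θ δ) (hw : ∀ j, 0 ≤ w j) (n : ℕ) (ω : Ω) :
    ∑ j, (ζ n ω).indicator (fun j => w j *
        ‖T (extrapolation a x n ω) j - extrapolation a x n ω j‖ ^ 2) j
      ≤ 2 / ρ ^ 2 * (weightedIncrSq w x (n + 1) ω + weightedIncrSq w x n ω) := by
  set Q := ∑ j, (ζ n ω).indicator (fun j => w j *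
    ‖T (extrapolation a x n ω) j - extrapolation a x n ω j‖ ^ 2) j with hQ
  have hQ_nonneg : 0 ≤ Q := Finset.sum_nonneg fun j _ =>
    Set.indicator_nonneg (fun j _ => mul_nonneg (hw j) (sq_nonneg _)) j
  have hstep : r n ^ 2 * Q = weightedNormSq w
      (x (n + 2) ω - x (n + 1) ω - a n • (x (n + 1) ω - x n ω)) := by
    rw [hQ, ← weightedNormSq_relaxedBlockStep_sub_self, ← hx.step, sub_sub, extrapolation]
  rw [div_mul_eq_mul_div, le_div_iff₀' (pow_pos hpar.rho_pos 2)]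
  calc ρ ^ 2 * Q
      ≤ r n ^ 2 * Q := by
        gcongr
        · exact hpar.rho_pos.le
        · exact hpar.rho_le n
    _ ≤ 2 * weightedIncrSq w x (n + 1) ω + 2 * (a n ^ 2 * weightedIncrSq w x n ω) := by
        rw [hstep, weightedIncrSq, weightedIncrSq, ← weightedNormSq_smul]
        exact weightedNormSq_sub_le hw _ _
    _ ≤ 2 * (weightedIncrSq w x (n + 1) ω + weightedIncrSq w x n ω) := by
        rw [mul_add]
        gcongr
        exact mul_le_of_le_one_left (weightedNormSq_nonneg hw _)
          (pow_le_one₀ (hpar.nonneg n) (hpar.le_one n))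

variable [IsProbabilityMeasure P]

theorem memLp_pair (hx : IsInertialBlockIteration T ζ a r x ℱ P) (hT : LipschitzWith 1 T)
    (hζ : ∀ n, Measurable[ℱ (n + 1)] (ζ n)) (n : ℕ) :
    MemLp (x n) 2 P ∧ MemLp (x (n + 1)) 2 P := by
  induction n with
  | zero => exact ⟨hx.memLp_zero, hx.memLp_one⟩
  | succ n ih =>
    have hy : MemLp (extrapolation a x n) 2 P := ih.2.add ((ih.2.sub ih.1).const_smul (a n))
    have hy_meas := (hx.stronglyMeasurable_extrapolation hT.continuous hζ n).mono
      (ℱ.mono n.le_succ)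
    have hblock_meas := (stronglyMeasurable_blockOperator hT.continuous (hζ n) hy_meas).sub hy_meas
    have hblock : MemLp (fun ω => blockOperator T (ζ n ω) (extrapolation a x n ω)
        - extrapolation a x n ω) 2 P :=
      ((memLp_comp_of_lipschitzWith hT hy).sub hy).of_le
        (hblock_meas.mono (ℱ.le _)).aestronglyMeasurable
        (ae_of_all _ fun ω => norm_blockOperator_sub_le T _ _)
    exact ⟨ih.2, (hy.add (hblock.const_smul (r n))).ae_eq (ae_of_all _ fun ω => (hx.step n ω).symm)⟩

theorem memLp (hx : IsInertialBlockIteration T ζ a r x ℱ P) (hT : LipschitzWith 1 T)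
    (hζ : ∀ n, Measurable[ℱ (n + 1)] (ζ n)) (n : ℕ) : MemLp (x n) 2 P :=
  (hx.memLp_pair hT hζ n).1

theorem memLp_extrapolation (hx : IsInertialBlockIteration T ζ a r x ℱ P)
    (hT : LipschitzWith 1 T) (hζ : ∀ n, Measurable[ℱ (n + 1)] (ζ n)) (n : ℕ) :
    MemLp (extrapolation a x n) 2 P :=
  (hx.memLp hT hζ (n + 1)).add
    (((hx.memLp hT hζ (n + 1)).sub (hx.memLp hT hζ n)).const_smul (a n))

theorem integrable_weightedDistSq (hx : IsInertialBlockIteration T ζ a r x ℱ P)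
    (hT : LipschitzWith 1 T) (hζ : ∀ n, Measurable[ℱ (n + 1)] (ζ n)) (w : Fin J → ℝ)
    (z : PiLp 2 Z) (n : ℕ) : Integrable (weightedDistSq w x z n) P :=
  integrable_weightedNormSq w ((hx.memLp hT hζ n).sub (memLp_const z))

theorem integrable_weightedIncrSq (hx : IsInertialBlockIteration T ζ a r x ℱ P)
    (hT : LipschitzWith 1 T) (hζ : ∀ n, Measurable[ℱ (n + 1)] (ζ n)) (w : Fin J → ℝ) (n : ℕ) :
    Integrable (weightedIncrSq w x n) P :=
  integrable_weightedNormSq w ((hx.memLp hT hζ (n + 1)).sub (hx.memLp hT hζ n))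

theorem integrable_blockExcess (hx : IsInertialBlockIteration T ζ a r x ℱ P)
    (hT : LipschitzWith 1 T) (hζ : ∀ n, Measurable[ℱ (n + 1)] (ζ n)) (z : PiLp 2 Z) (n : ℕ)
    (j : Fin J) : Integrable (blockExcess T a x z n j) P :=
  have hy := hx.memLp_extrapolation hT hζ n
  ((((memLp_comp_of_lipschitzWith hT hy).sub (memLp_const z)).eval_piLp
      j).integrable_norm_pow two_ne_zero).sub
    (((hy.sub (memLp_const z)).eval_piLp j).integrable_norm_pow two_ne_zero)

theorem condExp_selectedSum_blockExcess_nonpos (hx : IsInertialBlockIteration T ζ a r x ℱ P)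
    (hT : LipschitzWith 1 T) (hζ : IsBlockSelection ζ q ℱ P) (hz : T z = z) (n : ℕ) :
    P[fun ω => ∑ j, (ζ n ω).indicator (fun j => (q j)⁻¹ * blockExcess T a x z n j ω) j | ℱ n]
      ≤ᵐ[P] 0 := by
  filter_upwards [condExp_selectedSum (hζ.measurable_ambient n) (fun j => (hζ.pos j).ne')
    (hζ.condExp n) (hx.stronglyMeasurable_blockExcess hT.continuous hζ.measurable z n)
    (hx.integrable_blockExcess hT hζ.measurable z n)] with ω hω
  exact hω.trans_le (sum_blockExcess_nonpos hT hz a x n ω)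

theorem condExp_inertialEnergy_le (hx : IsInertialBlockIteration T ζ a r x ℱ P)
    (hT : LipschitzWith 1 T) (hζ : IsBlockSelection ζ q ℱ P)
    (hpar : InertialParameters a r α ρ θ δ) (hz : T z = z) (n : ℕ) :
    P[fun ω => inertialEnergy a (fun n => inertiaCoeff δ (a n) (r n))
        (weightedDistSq (fun j => (q j)⁻¹) x z) (weightedIncrSq (fun j => (q j)⁻¹) x) (n + 1) ω
        + θ * weightedIncrSq (fun j => (q j)⁻¹) x (n + 1) ω | ℱ n]
      ≤ᵐ[P] inertialEnergy a (fun n => inertiaCoeff δ (a n) (r n))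
        (weightedDistSq (fun j => (q j)⁻¹) x z) (weightedIncrSq (fun j => (q j)⁻¹) x) n := by
  set w : Fin J → ℝ := fun j => (q j)⁻¹
  set V := inertialEnergy a (fun n => inertiaCoeff δ (a n) (r n)) (weightedDistSq w x z)
    (weightedIncrSq w x)
  set S : Ω → ℝ := fun ω => ∑ j, (ζ n ω).indicator (fun j => w j * blockExcess T a x z n j ω) j
  have hdist := hx.integrable_weightedDistSq hT hζ.measurable w z
  have hincr := hx.integrable_weightedIncrSq hT hζ.measurable w
  have hV (m : ℕ) : Integrable (V m) P :=
    ((hdist (m + 1)).sub ((hdist m).const_mul _)).add ((hincr m).const_mul _)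
  have hS : Integrable S P := integrable_selectedSum (hζ.measurable_ambient n) fun j =>
    (hx.integrable_blockExcess hT hζ.measurable z n j).const_mul (w j)
  have hV_meas : StronglyMeasurable[ℱ n] (V n) :=
    hx.stronglyAdapted_inertialEnergy hT.continuous hζ.measurable w z _ n
  filter_upwards [condExp_mono (m := ℱ n) ((hV (n + 1)).add ((hincr (n + 1)).const_mul θ))
      ((hV n).add (hS.smul (r n))) (ae_of_all _ (hx.inertialEnergy_succ_add_le hpar
        (fun j => (inv_pos.2 (hζ.pos j)).le) z n)),
    condExp_add (hV n) (hS.smul (r n)) (ℱ n), condExp_smul (r n) S (ℱ n),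
    hx.condExp_selectedSum_blockExcess_nonpos hT hζ hz n] with ω hmono hadd hsmul hgap
  refine hmono.trans ?_
  rw [hadd, Pi.add_apply, hsmul, condExp_of_stronglyMeasurable (ℱ.le n) hV_meas (hV n)]
  exact add_le_of_nonpos_right (mul_nonpos_of_nonneg_of_nonpos (hpar.r_pos n).le hgap)

theorem isInertialSupermartingale (hx : IsInertialBlockIteration T ζ a r x ℱ P)
    (hT : LipschitzWith 1 T) (hζ : IsBlockSelection ζ q ℱ P)
    (hpar : InertialParameters a r α ρ θ δ) (hz : T z = z) :
    IsInertialSupermartingale (weightedDistSq (fun j => (q j)⁻¹) x z)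
      (weightedIncrSq (fun j => (q j)⁻¹) x) a (fun n => inertiaCoeff δ (a n) (r n)) θ ℱ P where
  nonneg_dist _ _ := weightedNormSq_nonneg (fun j => (inv_pos.2 (hζ.pos j)).le) _
  nonneg_incr _ _ := weightedNormSq_nonneg (fun j => (inv_pos.2 (hζ.pos j)).le) _
  integrable_dist := hx.integrable_weightedDistSq hT hζ.measurable _ z
  integrable_incr := hx.integrable_weightedIncrSq hT hζ.measurable _
  adapted := hx.stronglyAdapted_inertialEnergy hT.continuous hζ.measurable _ z _
  condExp_le := hx.condExp_inertialEnergy_le hT hζ hpar hz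

theorem integral_residual_le (hx : IsInertialBlockIteration T ζ a r x ℱ P)
    (hT : LipschitzWith 1 T) (hζ : IsBlockSelection ζ q ℱ P)
    (hpar : InertialParameters a r α ρ θ δ) (n : ℕ) :
    ∫ ω, ‖T (extrapolation a x n ω) - extrapolation a x n ω‖ ^ 2 ∂P
      ≤ 2 / ρ ^ 2 * (∫ ω, weightedIncrSq (fun j => (q j)⁻¹) x (n + 1) ω ∂P
        + ∫ ω, weightedIncrSq (fun j => (q j)⁻¹) x n ω ∂P) := by
  have hy_meas := hx.stronglyMeasurable_extrapolation hT.continuous hζ.measurable n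
  have hy := hx.memLp_extrapolation hT hζ.measurable n
  have hR (j : Fin J) : Integrable
      (fun ω => ‖T (extrapolation a x n ω) j - extrapolation a x n ω j‖ ^ 2) P :=
    (((memLp_comp_of_lipschitzWith hT hy).sub hy).eval_piLp j).integrable_norm_pow two_ne_zero
  have hR_meas (j : Fin J) : StronglyMeasurable[ℱ n]
      fun ω => ‖T (extrapolation a x n ω) j - extrapolation a x n ω j‖ ^ 2 :=
    stronglyMeasurable_norm_apply_sq
      ((hT.continuous.comp_stronglyMeasurable hy_meas).sub hy_meas) j
  have hincr := hx.integrable_weightedIncrSq hT hζ.measurable (fun j => (q j)⁻¹)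
  simp only [PiLp.norm_sq_eq_of_L2, PiLp.sub_apply]
  rw [← integral_add (hincr (n + 1)) (hincr n), ← integral_const_mul,
    ← integral_congr_ae (condExp_selectedSum (hζ.measurable_ambient n)
      (fun j => (hζ.pos j).ne') (hζ.condExp n) hR_meas hR), integral_condExp (ℱ.le n)]
  exact integral_mono
    (integrable_selectedSum (hζ.measurable_ambient n) fun j => (hR j).const_mul (q j)⁻¹)
    (((hincr (n + 1)).add (hincr n)).const_mul _)
    (hx.sum_indicator_residual_le hpar (fun j => (inv_pos.2 (hζ.pos j)).le) n)

theorem ae_tendsto_residual (hx : IsInertialBlockIteration T ζ a r x ℱ P)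
    (hT : LipschitzWith 1 T) (hζ : IsBlockSelection ζ q ℱ P)
    (hpar : InertialParameters a r α ρ θ δ) (hz : T z = z) :
    ∀ᵐ ω ∂P, Tendsto (fun n => T (x n ω) - x n ω) atTop (𝓝 0) := by
  have hsuper := hx.isInertialSupermartingale hT hζ hpar hz
  have hsum := hsuper.summable_integral_incr hpar.theta_pos hpar.alpha_nonneg hpar.lt_one hpar.le
    hpar.inertiaCoeff_nonneg
  have hres_sum : Summable fun n =>
      ∫ ω, ‖T (extrapolation a x n ω) - extrapolation a x n ω‖ ^ 2 ∂P :=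
    .of_nonneg_of_le (fun n => integral_nonneg fun ω => sq_nonneg _)
      (hx.integral_residual_le hT hζ hpar)
      ((((summable_nat_add_iff 1).2 hsum).add hsum).mul_left _)
  have hres_int (n : ℕ) : Integrable
      (fun ω => ‖T (extrapolation a x n ω) - extrapolation a x n ω‖ ^ 2) P :=
    have hy := hx.memLp_extrapolation hT hζ.measurable n
    ((memLp_comp_of_lipschitzWith hT hy).sub hy).integrable_norm_pow two_ne_zero
  filter_upwards [ae_tendsto_zero_of_summable_integral hres_int (fun n ω => sq_nonneg _) hres_sum,
    hsuper.ae_tendsto_incr hpar.theta_pos hpar.alpha_nonneg hpar.lt_one hpar.le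
      hpar.inertiaCoeff_nonneg] with ω hres hincr
  refine (tendsto_add_atTop_iff_nat 1).1 (tendsto_apply_sub_self_of_tendsto_sub hT
    (tendsto_zero_of_norm_sq_le (fun n => le_rfl) hres) (tendsto_zero_of_norm_sq_le (fun n => ?_)
      hincr))
  exact norm_extrapolation_sub_sq_le hζ.one_le_inv (hpar.nonneg n) (hpar.le_one n) x ω

theorem ae_exists_tendsto_weightedDistSq (hx : IsInertialBlockIteration T ζ a r x ℱ P)
    (hT : LipschitzWith 1 T) (hζ : IsBlockSelection ζ q ℱ P)
    (hpar : InertialParameters a r α ρ θ δ) (hz : T z = z) :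
    ∀ᵐ ω ∂P, ∃ l, Tendsto (fun n => weightedDistSq (fun j => (q j)⁻¹) x z n ω) atTop (𝓝 l) :=
  (hx.isInertialSupermartingale hT hζ hpar hz).ae_exists_tendsto_dist hpar.theta_pos hpar.lt_one
    hpar.nonneg hpar.le hpar.exists_tendsto hpar.inertiaCoeff_nonneg hpar.inertiaCoeff_le

end IsInertialBlockIteration

end Iteration

/-! ### Convergence -/

theorem exists_tendsto_of_dense_of_mapClusterPt_mem {X : Type*} [TopologicalSpace X] {K F D : Set X}
    (hK : IsCompact K) {g : X → X → ℝ} (hg : Continuous ↿g) (hg_eq : ∀ y z, g y z = g z z → y = z)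
    (hD : F ⊆ closure D) {x : ℕ → X} (hxK : ∀ n, x n ∈ K)
    (hlim : ∀ z ∈ D, ∃ l, Tendsto (fun n => g (x n) z) atTop (𝓝 l))
    (hcluster : ∀ y, MapClusterPt y atTop x → y ∈ F) :
    ∃ y ∈ F, Tendsto x atTop (𝓝 y) := by
  have hval {y z : X} {l : ℝ} (hy : MapClusterPt y atTop x)
      (hl : Tendsto (fun n => g (x n) z) atTop (𝓝 l)) : g y z = l :=
    have hgy : MapClusterPt (g y z) atTop fun n => g (x n) z :=
      hy.continuousAt_comp (f := fun u => g u z) (by fun_prop)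
    eq_of_nhds_neBot (hgy.neBot.mono (inf_le_inf_left _ hl))
  have hagree {y y' : X} (hy : MapClusterPt y atTop x) (hy' : MapClusterPt y' atTop x) :
      F ⊆ {z | g y z = g y' z} :=
    hD.trans <| closure_minimal (fun z hz => have ⟨_, hl⟩ := hlim z hz
      (hval hy hl).trans (hval hy' hl).symm) (isClosed_eq (by fun_prop) (by fun_prop))
  obtain ⟨y, -, hy⟩ := hK.exists_mapClusterPt (f := atTop) (u := x) (by simp [hxK])
  exact ⟨y, hcluster y hy, hK.tendsto_nhds_of_unique_mapClusterPt (.of_forall hxK) fun y' _ hy' =>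
    hg_eq y' y (hagree hy' hy (hcluster y hy))⟩

theorem apply_eq_self_of_mapClusterPt {E : Type*} [NormedAddCommGroup E] {T : E → E}
    (hT : Continuous T) {x : ℕ → E} (hx : Tendsto (fun n => T (x n) - x n) atTop (𝓝 0)) {y : E}
    (hy : MapClusterPt y atTop x) : T y = y := by
  have hTy : MapClusterPt (T y - y) atTop fun n => T (x n) - x n :=
    hy.continuousAt_comp (f := fun u => T u - u) (by fun_prop)
  exact sub_eq_zero.1 (eq_of_nhds_neBot (hTy.neBot.mono (inf_le_inf_left _ hx)))

theorem exists_fixedPoint_tendsto_of_weightedNormSq {J : ℕ} {Z : Fin J → Type*}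
    [∀ j, NormedAddCommGroup (Z j)] [∀ j, InnerProductSpace ℝ (Z j)]
    [∀ j, FiniteDimensional ℝ (Z j)] {T : PiLp 2 Z → PiLp 2 Z} (hT : Continuous T) {w : Fin J → ℝ}
    (hw : ∀ j, 1 ≤ w j) {D : Set (PiLp 2 Z)} (hD_ne : D.Nonempty)
    (hD : Function.fixedPoints T ⊆ closure D) {x : ℕ → PiLp 2 Z}
    (hlim : ∀ z ∈ D, ∃ l, Tendsto (fun n => weightedNormSq w (x n - z)) atTop (𝓝 l))
    (hres : Tendsto (fun n => T (x n) - x n) atTop (𝓝 0)) :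
    ∃ y ∈ Function.fixedPoints T, Tendsto x atTop (𝓝 y) := by
  obtain ⟨z₀, hz₀⟩ := hD_ne
  obtain ⟨l, hl⟩ := hlim z₀ hz₀
  obtain ⟨C, hC⟩ := hl.bddAbove_range
  have hball (n : ℕ) : x n ∈ Metric.closedBall z₀ √C :=
    mem_closedBall_iff_norm.2 <| Real.le_sqrt_of_sq_le <|
      (norm_sq_le_weightedNormSq hw _).trans (hC (Set.mem_range_self n))
  exact exists_tendsto_of_dense_of_mapClusterPt_mem (isCompact_closedBall z₀ √C)
    (g := fun u z => weightedNormSq w (u - z))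
    ((continuous_weightedNormSq w).comp (continuous_fst.sub continuous_snd))
    (fun y z h => eq_of_weightedNormSq_sub_eq_zero hw (by simpa [weightedNormSq] using h)) hD hball
    hlim fun y hy => apply_eq_self_of_mapClusterPt hT hres hy

theorem theorem5p1_general {J : ℕ} {Z : Fin J → Type*} [∀ j, NormedAddCommGroup (Z j)]
    [∀ j, InnerProductSpace ℝ (Z j)] [∀ j, FiniteDimensional ℝ (Z j)]
    {T : PiLp 2 Z → PiLp 2 Z} (hT : LipschitzWith 1 T) (hFix : (Function.fixedPoints T).Nonempty)
    {Ω : Type*} [mΩ : MeasurableSpace Ω] {P : Measure Ω} [IsProbabilityMeasure P]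
    {ℱ : Filtration ℕ mΩ} {ζ : ℕ → Ω → Set (Fin J)} {q : Fin J → ℝ}
    (hζ : IsBlockSelection ζ q ℱ P) {a r : ℕ → ℝ} {α ρ θ δ : ℝ}
    (hpar : InertialParameters a r α ρ θ δ) {x : ℕ → Ω → PiLp 2 Z}
    (hx : IsInertialBlockIteration T ζ a r x ℱ P) :
    ∀ᵐ ω ∂P, ∃ y ∈ Function.fixedPoints T, Tendsto (fun n => x n ω) atTop (𝓝 y) := by
  obtain ⟨D, hD_fixed, hD_count, hD_dense⟩ := (TopologicalSpace.IsSeparable.of_separableSpace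
    (Function.fixedPoints T)).exists_countable_dense_subset
  have hD_ne : D.Nonempty := closure_nonempty_iff.1 (hFix.mono hD_dense)
  obtain ⟨z, hz⟩ := hFix
  filter_upwards [(ae_ball_iff hD_count).2 fun u hu =>
      hx.ae_exists_tendsto_weightedDistSq hT hζ hpar (hD_fixed hu),
    hx.ae_tendsto_residual hT hζ hpar hz] with ω hlim hres
  exact exists_fixedPoint_tendsto_of_weightedNormSq hT.continuous hζ.one_le_inv hD_ne hD_dense
    hlim hres

theorem theorem5p1 {J : ℕ} {Z : Fin J → Type*} [∀ j, NormedAddCommGroup (Z j)]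
    [∀ j, InnerProductSpace ℝ (Z j)] [∀ j, FiniteDimensional ℝ (Z j)]
    (T : PiLp 2 Z → PiLp 2 Z) (hT : LipschitzWith 1 T) (hFix : (Function.fixedPoints T).Nonempty)
    {Ω : Type*} [MeasurableSpace Ω] (P : MeasureTheory.Measure Ω)
    [MeasureTheory.IsProbabilityMeasure P]
    (ζ : ℕ+ → Ω → Set (Fin J)) (hζ_meas : ∀ k, Measurable (ζ k))
    (hζ_indep : ProbabilityTheory.iIndepFun ζ P)
    (hζ_ident : ∀ k, ProbabilityTheory.IdentDistrib (ζ k) (ζ 1) P P)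
    (hζ_pos : ∀ j : Fin J, ∃ ϑ : Set (Fin J), j ∈ ϑ ∧ 0 < P {ω | ζ 1 ω = ϑ})
    (a r : ℕ → ℝ) (α ρ θ δ : ℝ)
    (ha_mono : MonotoneOn a (Set.Ici 1)) (ha_one : a 1 = 0)
    (ha_bound : ∀ k, 1 ≤ k → 0 ≤ a k ∧ a k ≤ α) (hα : α < 1)
    (hρ : 0 < ρ) (hθ : 0 < θ) (hδ : 0 < δ)
    (hδ_bound : δ > (α ^ 2 * (1 + α) + α * θ) / (1 - α ^ 2))
    (hr_bound : ∀ k, 1 ≤ k → ρ ≤ r k ∧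
      r k < (δ - α * (α * (1 + α) + α * δ + θ)) / (δ * (1 + α * (1 + α) + α * δ + θ)))
    (x₀ x₁ : PiLp 2 Z) (x : ℕ → Ω → PiLp 2 Z)
    (hx_zero : ∀ ω, x 0 ω = x₀) (hx_one : ∀ ω, x 1 ω = x₁)
    (hx_step : ∀ k, 1 ≤ k → ∀ ω,
      x (k + 1) ω = x k ω + a k • (x k ω - x (k - 1) ω)
        + r k • (blockOperator T (ζ k.succPNat ω) (x k ω + a k • (x k ω - x (k - 1) ω))
          - x k ω - a k • (x k ω - x (k - 1) ω))) :
    ∀ᵐ ω ∂P, ∃ y ∈ Function.fixedPoints T,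
      Filter.Tendsto (fun k => x k ω) Filter.atTop (nhds y) := by
  have hx : IsInertialBlockIteration T (fun n => ζ (n + 1).succPNat) (fun n => a (n + 1))
      (fun n => r (n + 1)) x (pastFiltration _ fun n => hζ_meas (n + 1).succPNat) P :=
    .of_const hx_zero hx_one fun n ω => (hx_step (n + 1) n.succ_pos ω).trans (by rw [sub_sub]; rfl)
  have hpar : InertialParameters (fun n => a (n + 1)) (fun n => r (n + 1)) α ρ θ δ :=
    { mono := fun m n hmn => ha_mono (by simp) (by simp) (by omega)
      nonneg := fun n => (ha_bound _ n.succ_pos).1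
      le := fun n => (ha_bound _ n.succ_pos).2
      lt_one := hα
      rho_pos := hρ
      theta_pos := hθ
      delta_pos := hδ
      rho_le := fun n => (hr_bound _ n.succ_pos).1
      r_lt := fun n => (hr_bound _ n.succ_pos).2 }
  have hinj : Function.Injective fun n : ℕ => (n + 1).succPNat :=
    Nat.succPNat_injective.comp Nat.succ_injective
  exact theorem5p1_general hT hFix (.of_identDistrib (fun n => hζ_meas _)
    (hζ_indep.precomp hinj) (fun n => hζ_ident _) hζ_pos) hpar hx
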